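/- **Lemma 2.3.** For a finite set $A\subset\mathbb{R}$ let $$E^*(A)=\left|\{(a_1,a_2,a_3,a_4)\in A^4 : a_1a_2=a_3a_4\}\right|$$ be its multiplicative energy, and for finite $A,B,C\subset\mathbb{R}$ write $B+C=\{b+c : b\in B,\ c\in C\}$ and $A(B+C)=\{a(b+c) : a\in A,\ b\in B,\ c\in C\}$. There is an absolute constant $\kappa>0$ such that for all finite sets $A,B,C\subset\mathbb{R}$ with $|A|\ge 2$ and $B+C\neq\{0\}$, $$E^*(A)\,|A(B+C)|^2\ \ge\ \kappa\,\frac{|A|^4\,|B|\,|C|}{\log_2|A|}.$$ -/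

import Mathlib

open scoped Pointwise

/-! Discard 0 from A and the pairs with b + c = 0. If S counts the solutions of a(b+c) = a'(b'+c'),
Cauchy–Schwarz over the values gives |A|²|B|²|C|² ≪ |A(B+C)|·S. Grouping by x = a/a' and applying
Cauchy–Schwarz again gives S² ≤ E*(A)·∑ q(x)², with q = `sumRatioCount`, so it remains to show ∑
q(x)² ≪ N³ log|A|, N = |B||C|.

Now q(x) is controlled by pairs of grid points on lines of slope x. The key input is a
Szemerédi–Trotter type bound, `card_mul_sq_le_of_le_slopeEnergy`: O(N³/t²) slopes have energy at
least t. It comes from an elementary cell decomposition, available because the points form a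
Cartesian product. `sum_sq_le_mul_harmonic` turns this tail bound into a second moment, at the cost
of the logarithm. -/

/-- The number of ordered pairs of elements of `T` on which `f` takes the same value. -/
def collisions {α β : Type*} [DecidableEq β] (f : α → β) (T : Finset α) : ℕ :=
  ((T ×ˢ T).filter fun z => f z.1 = f z.2).card

/-! ### Collision counts and Cauchy–Schwarz. -/

section Counting

variable {α α' β : Type*} [DecidableEq β]

lemma card_pairs_eq_sum_mul (f : α → β) (g : α' → β) (T : Finset α) (T' : Finset α')
    (Y : Finset β) (hY : ∀ p ∈ T, f p ∈ Y) :
    ((T ×ˢ T').filter fun z => f z.1 = g z.2).card =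
      ∑ y ∈ Y, (T.filter fun p => f p = y).card * (T'.filter fun q => g q = y).card := by
  rw [Finset.card_eq_sum_card_fiberwise (f := fun z : α × α' => f z.1) (t := Y)]
  · refine Finset.sum_congr rfl fun y _ => ?_
    rw [← Finset.card_product]
    congr 1
    ext ⟨p, q⟩
    simp only [Finset.mem_filter, Finset.mem_product]
    constructor
    · rintro ⟨⟨⟨hp, hq⟩, h⟩, hy⟩
      exact ⟨⟨hp, hy⟩, hq, h ▸ hy⟩
    · rintro ⟨⟨hp, hy⟩, hq, h⟩
      exact ⟨⟨⟨hp, hq⟩, hy.trans h.symm⟩, hy⟩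
  · intro z hz
    simp only [Finset.coe_filter, Finset.mem_product, Set.mem_ofPred_eq] at hz
    exact hY _ hz.1.1

lemma collisions_eq_sum_sq (f : α → β) (T : Finset α) (Y : Finset β) (hY : ∀ p ∈ T, f p ∈ Y) :
    collisions f T = ∑ y ∈ Y, (T.filter fun p => f p = y).card ^ 2 := by
  simp only [collisions, card_pairs_eq_sum_mul f f T T Y hY, sq]

lemma card_sq_le_card_mul_collisions (f : α → β) (T : Finset α) (Y : Finset β)
    (hY : ∀ p ∈ T, f p ∈ Y) : T.card ^ 2 ≤ Y.card * collisions f T := by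
  rw [collisions_eq_sum_sq f T Y hY, Finset.card_eq_sum_card_fiberwise hY]
  exact sq_sum_le_card_mul_sum_sq

lemma two_mul_card_pairs_le (f : α → β) (g : α' → β) (T : Finset α) (T' : Finset α') :
    2 * ((T ×ˢ T').filter fun z => f z.1 = g z.2).card ≤ collisions f T + collisions g T' := by
  have hf : ∀ p ∈ T, f p ∈ T.image f ∪ T'.image g := fun p hp =>
    Finset.mem_union_left _ (Finset.mem_image_of_mem f hp)
  have hg : ∀ p ∈ T', g p ∈ T.image f ∪ T'.image g := fun p hp =>
    Finset.mem_union_right _ (Finset.mem_image_of_mem g hp)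
  rw [card_pairs_eq_sum_mul f g T T' _ hf, collisions_eq_sum_sq f T _ hf,
    collisions_eq_sum_sq g T' _ hg, ← Finset.sum_add_distrib, Finset.mul_sum]
  refine Finset.sum_le_sum fun y _ => ?_
  rw [← mul_assoc]
  exact two_mul_le_add_sq _ _

/-- Cauchy–Schwarz on each fibre of `f`, which `j` cuts into at most `n` classes. -/
lemma collisions_le_mul_collisions_refined (f : α → β) (T : Finset α) (j : α → ℕ) (n : ℕ)
    (hj : ∀ p ∈ T, j p < n) :
    collisions f T ≤ n * collisions (fun p => (f p, j p)) T := by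
  have hf : ∀ p ∈ T, f p ∈ T.image f := fun p hp => Finset.mem_image_of_mem f hp
  rw [collisions_eq_sum_sq f T _ hf,
    collisions_eq_sum_sq (fun p => (f p, j p)) T (T.image f ×ˢ Finset.range n)
      (fun p hp => Finset.mem_product.2 ⟨hf p hp, Finset.mem_range.2 (hj p hp)⟩),
    Finset.sum_product, Finset.mul_sum]
  refine Finset.sum_le_sum fun y _ => ?_
  have hmaps : ∀ p ∈ T.filter (fun p => f p = y), j p ∈ Finset.range n := fun p hp =>
    Finset.mem_range.2 (hj p (Finset.mem_filter.1 hp).1)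
  rw [Finset.card_eq_sum_card_fiberwise hmaps]
  refine sq_sum_le_card_mul_sum_sq.trans (le_of_eq ?_)
  simp only [Finset.card_range, Finset.filter_filter, Prod.mk.injEq, Nat.cast_id]

end Counting

/-! ### Lines and blocks in a Cartesian product. -/

/-- A finite set of reals can be cut into `s` intervals with about equally many elements. -/
lemma exists_monotone_equipartition (B : Finset ℝ) (s : ℕ) (hs : 1 ≤ s) (hsB : s ≤ B.card) :
    ∃ u : ℝ → ℕ, Monotone u ∧ (∀ b ∈ B, u b < s) ∧
      ∀ i, s * (B.filter fun b => u b = i).card ≤ 2 * B.card := by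
  set rank : ℝ → ℕ := fun b => (B.filter fun b' => b' < b).card with hrank
  -- Rounding up strictly gives |B| < s·w, hence fewer than s + 1 classes; s ≤ |B| keeps s·w ≤ 2|B|.
  set w := B.card / s + 1 with hw
  have hw0 : 0 < w := Nat.succ_pos _
  have hmono : Monotone rank := fun a b hab =>
    Finset.card_le_card fun x hx => by
      simp only [Finset.mem_filter] at hx ⊢
      exact ⟨hx.1, hx.2.trans_le hab⟩
  have hstrict : ∀ a ∈ B, ∀ b, a < b → rank a < rank b := fun a ha b hab => by
    refine Finset.card_lt_card ⟨fun x hx => ?_, fun h => ?_⟩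
    · simp only [Finset.mem_filter] at hx ⊢
      exact ⟨hx.1, hx.2.trans hab⟩
    · have := h (Finset.mem_filter.2 ⟨ha, hab⟩)
      simp at this
  have hlt : ∀ b ∈ B, rank b < B.card := fun b hb => by
    refine Finset.card_lt_card ⟨Finset.filter_subset _ _, fun h => ?_⟩
    have := h hb
    simp at this
  refine ⟨fun b => rank b / w, fun a b hab => Nat.div_le_div_right (hmono hab), fun b hb => ?_,
    fun i => ?_⟩
  · rw [Nat.div_lt_iff_lt_mul hw0]
    have := Nat.lt_mul_div_succ B.card hs
    exact (hlt b hb).trans this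
  · have hcard : (B.filter fun b => rank b / w = i).card ≤ w := by
      have : (B.filter fun b => rank b / w = i).card ≤ (Finset.Ico (i * w) (i * w + w)).card := by
        refine Finset.card_le_card_of_injOn rank (fun b hb => ?_) (fun a ha b hb hab => ?_)
        · simp only [Finset.coe_filter, Set.mem_ofPred_eq] at hb
          have h1 := Nat.div_mul_le_self (rank b) w
          have h2 := Nat.lt_div_mul_add (a := rank b) hw0
          rw [hb.2] at h1 h2
          simp only [Finset.coe_Ico, Set.mem_Ico]
          exact ⟨h1, h2⟩
        · simp only [Finset.coe_filter, Set.mem_ofPred_eq] at ha hb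
          rcases lt_trichotomy a b with h | h | h
          · exact absurd hab (hstrict a ha.1 b h).ne
          · exact h
          · exact absurd hab (hstrict b hb.1 a h).ne'
      simpa using this
    calc s * _ ≤ s * w := Nat.mul_le_mul_left _ hcard
      _ = s * (B.card / s) + s := by rw [hw, mul_add, mul_one]
      _ ≤ B.card + B.card := Nat.add_le_add (Nat.mul_div_le _ _) hsB
      _ = 2 * B.card := (two_mul _).symm

/-- The number of pairs of points of `B × C` lying on a common line of slope `x`. -/
noncomputable def slopeEnergy (B C : Finset ℝ) (x : ℝ) : ℕ :=
  collisions (fun p : ℝ × ℝ => p.2 - x * p.1) (B ×ˢ C)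

/-- On a line of given slope through a known point, the abscissa fixes the second point. This bound
and the next ensure that the number of cuts never exceeds |B| or |C|. -/
lemma slopeEnergy_le_mul_card_left (B C : Finset ℝ) (x : ℝ) :
    slopeEnergy B C x ≤ B.card * C.card * B.card := by
  rw [slopeEnergy, collisions, ← Finset.card_product, ← Finset.card_product]
  refine Finset.card_le_card_of_injOn (fun z => (z.1, z.2.1)) (fun z hz => ?_) ?_
  · simp only [Finset.coe_filter, Finset.mem_product, Set.mem_ofPred_eq] at hz
    simp only [Finset.mem_coe, Finset.mem_product]
    exact ⟨hz.1.1, hz.1.2.1⟩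
  · rintro ⟨⟨a, b⟩, ⟨c, d⟩⟩ hz ⟨⟨a', b'⟩, ⟨c', d'⟩⟩ hz' h
    simp only [Finset.coe_filter, Set.mem_ofPred_eq] at hz hz'
    simp only [Prod.mk.injEq] at h ⊢
    obtain ⟨⟨rfl, rfl⟩, rfl⟩ := h
    exact ⟨⟨rfl, rfl⟩, rfl, by linarith [hz.2, hz'.2]⟩

lemma slopeEnergy_le_mul_card_right (B C : Finset ℝ) {x : ℝ} (hx : x ≠ 0) :
    slopeEnergy B C x ≤ B.card * C.card * C.card := by
  rw [slopeEnergy, collisions, ← Finset.card_product, ← Finset.card_product]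
  refine Finset.card_le_card_of_injOn (fun z => (z.1, z.2.2)) (fun z hz => ?_) ?_
  · simp only [Finset.coe_filter, Finset.mem_product, Set.mem_ofPred_eq] at hz
    simp only [Finset.mem_coe, Finset.mem_product]
    exact ⟨hz.1.1, hz.1.2.2⟩
  · rintro ⟨⟨a, b⟩, ⟨c, d⟩⟩ hz ⟨⟨a', b'⟩, ⟨c', d'⟩⟩ hz' h
    simp only [Finset.coe_filter, Set.mem_ofPred_eq] at hz hz'
    simp only [Prod.mk.injEq] at h ⊢
    obtain ⟨⟨rfl, rfl⟩, rfl⟩ := h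
    refine ⟨⟨rfl, rfl⟩, mul_left_cancel₀ hx ?_, rfl⟩
    linarith [hz.2, hz'.2]

/-- A non-vertical line meets at most `2 * s` blocks of an `s × s` grid of blocks. -/
lemma slopeEnergy_le_mul_blocks (B C : Finset ℝ) (x : ℝ) (s : ℕ) (u v : ℝ → ℕ)
    (hu : Monotone u) (hv : Monotone v) (hus : ∀ b ∈ B, u b < s) (hvs : ∀ c ∈ C, v c < s) :
    slopeEnergy B C x ≤ 2 * s *
      (((B ×ˢ C) ×ˢ (B ×ˢ C)).filter fun z : (ℝ × ℝ) × (ℝ × ℝ) =>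
        z.1.2 - x * z.1.1 = z.2.2 - x * z.2.1 ∧ u z.1.1 = u z.2.1 ∧ v z.1.2 = v z.2.2).card := by
  -- Along a line both block indices are monotone, in the same direction if x > 0 and in opposite
  -- ones otherwise. Hence this one number, below 2s, determines the block.
  set j : ℝ × ℝ → ℕ := fun p => if 0 < x then u p.1 + v p.2 else u p.1 + (s - v p.2) with hj
  have hjs : ∀ p ∈ B ×ˢ C, j p < 2 * s := by
    intro p hp
    have h1 := hus _ (Finset.mem_product.1 hp).1
    have h2 := hvs _ (Finset.mem_product.1 hp).2
    simp only [hj]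
    split_ifs <;> omega
  refine (collisions_le_mul_collisions_refined _ _ j _ hjs).trans
    (Nat.mul_le_mul_left _ (Finset.card_le_card fun z hz => ?_))
  obtain ⟨⟨a, b⟩, ⟨c, d⟩⟩ := z
  simp only [Finset.mem_filter, Finset.mem_product, Prod.mk.injEq] at hz ⊢
  obtain ⟨⟨⟨ha, hb⟩, hc, hd⟩, hl, hjj⟩ := hz
  refine ⟨⟨⟨ha, hb⟩, hc, hd⟩, hl, ?_⟩
  have hb' := hvs _ hb
  have hd' := hvs _ hd
  have hl' : b - d = x * (a - c) := by linarith
  rcases le_total a c with hac | hac <;> have hu1 := hu hac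
  · by_cases h0 : 0 < x
    · have hbd : b ≤ d := by nlinarith
      have hv1 := hv hbd
      simp only [hj, if_pos h0] at hjj
      omega
    · have hbd : d ≤ b := by nlinarith
      have hv1 := hv hbd
      simp only [hj, if_neg h0] at hjj
      omega
  · by_cases h0 : 0 < x
    · have hbd : d ≤ b := by nlinarith
      have hv1 := hv hbd
      simp only [hj, if_pos h0] at hjj
      omega
    · have hbd : b ≤ d := by nlinarith
      have hv1 := hv hbd
      simp only [hj, if_neg h0] at hjj
      omega

lemma mul_card_pairs_same_class_le (B : Finset ℝ) (s : ℕ) (u : ℝ → ℕ)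
    (hu : ∀ i, s * (B.filter fun b => u b = i).card ≤ 2 * B.card) :
    s * collisions u B ≤ 2 * B.card ^ 2 := by
  have hY : ∀ p ∈ B, u p ∈ B.image u := fun p hp => Finset.mem_image_of_mem u hp
  calc s * collisions u B
      = ∑ y ∈ B.image u, s * (B.filter fun b => u b = y).card * (B.filter fun b => u b = y).card := by
        rw [collisions_eq_sum_sq u B _ hY, Finset.mul_sum]
        exact Finset.sum_congr rfl fun y _ => by ring
    _ ≤ ∑ y ∈ B.image u, 2 * B.card * (B.filter fun b => u b = y).card :=
        Finset.sum_le_sum fun y _ => Nat.mul_le_mul_right _ (hu y)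
    _ = 2 * B.card ^ 2 := by
        rw [← Finset.mul_sum, ← Finset.card_eq_sum_card_fiberwise hY]
        ring

lemma card_same_block_le (B C : Finset ℝ) (u v : ℝ → ℕ) :
    (((B ×ˢ C) ×ˢ (B ×ˢ C)).filter fun z : (ℝ × ℝ) × (ℝ × ℝ) =>
      u z.1.1 = u z.2.1 ∧ v z.1.2 = v z.2.2).card ≤ collisions u B * collisions v C := by
  rw [collisions, collisions, ← Finset.card_product]
  refine Finset.card_le_card_of_injOn (fun z => ((z.1.1, z.2.1), (z.1.2, z.2.2)))
    (fun z hz => ?_) ?_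
  · simp only [Finset.coe_filter, Finset.mem_product, Set.mem_ofPred_eq] at hz
    simp only [Finset.mem_coe, Finset.mem_product, Finset.mem_filter]
    tauto
  · rintro ⟨⟨a, b⟩, ⟨c, d⟩⟩ _ ⟨⟨a', b'⟩, ⟨c', d'⟩⟩ _ h
    simp only [Prod.mk.injEq] at h ⊢
    tauto

/-- Distinct points on a common non-vertical line determine its slope. -/
lemma sum_card_line_block_le (B C X : Finset ℝ) (u v : ℝ → ℕ) :
    ∑ x ∈ X, (((B ×ˢ C) ×ˢ (B ×ˢ C)).filter fun z : (ℝ × ℝ) × (ℝ × ℝ) =>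
        z.1.2 - x * z.1.1 = z.2.2 - x * z.2.1 ∧ u z.1.1 = u z.2.1 ∧ v z.1.2 = v z.2.2).card ≤
      X.card * (B.card * C.card) + collisions u B * collisions v C := by
  set P := (B ×ˢ C) ×ˢ (B ×ˢ C) with hP
  have hsplit : ∀ x ∈ X, (P.filter fun z : (ℝ × ℝ) × (ℝ × ℝ) =>
        z.1.2 - x * z.1.1 = z.2.2 - x * z.2.1 ∧ u z.1.1 = u z.2.1 ∧ v z.1.2 = v z.2.2).card ≤
      B.card * C.card + (P.filter fun z : (ℝ × ℝ) × (ℝ × ℝ) =>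
        (u z.1.1 = u z.2.1 ∧ v z.1.2 = v z.2.2) ∧
        z.1.1 ≠ z.2.1 ∧ (z.1.2 - z.2.2) / (z.1.1 - z.2.1) = x).card := by
    intro x _
    rw [← Finset.card_product, ← Finset.diag_card (B ×ˢ C)]
    refine (Finset.card_le_card ?_).trans (Finset.card_union_le _ _)
    rintro ⟨⟨a, b⟩, ⟨c, d⟩⟩ hz
    simp only [Finset.mem_filter, Finset.mem_union, Finset.mem_diag, hP, Finset.mem_product,
      Prod.mk.injEq] at hz ⊢
    obtain ⟨⟨⟨ha, hb⟩, hc, hd⟩, hl, huv⟩ := hz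
    by_cases hac : a = c
    · subst hac
      exact Or.inl ⟨⟨ha, hb⟩, rfl, by linarith⟩
    · refine Or.inr ⟨⟨⟨ha, hb⟩, hc, hd⟩, huv, hac, ?_⟩
      rw [div_eq_iff (sub_ne_zero.2 hac)]
      linarith
  refine (Finset.sum_le_sum hsplit).trans ?_
  rw [Finset.sum_add_distrib, Finset.sum_const, smul_eq_mul]
  refine Nat.add_le_add_left (le_trans ?_ (card_same_block_le B C u v)) _
  rw [← Finset.card_biUnion]
  · refine Finset.card_le_card fun z hz => ?_
    simp only [Finset.mem_biUnion, Finset.mem_filter] at hz ⊢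
    obtain ⟨x, _, hz1, hz2, _⟩ := hz
    exact ⟨hz1, hz2⟩
  · intro x _ y _ hxy
    refine Finset.disjoint_left.2 fun z hz hz' => hxy ?_
    simp only [Finset.mem_filter] at hz hz'
    exact hz.2.2.2.symm.trans hz'.2.2.2

/-- Few slopes have large energy. -/
lemma card_mul_sq_le_of_le_slopeEnergy (B C X : Finset ℝ) (hX : ∀ x ∈ X, x ≠ 0) (t : ℝ)
    (hN : 0 < B.card * C.card) (ht : 4 * ((B.card * C.card : ℕ) : ℝ) ≤ t)
    (h : ∀ x ∈ X, t ≤ slopeEnergy B C x) :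
    (X.card : ℝ) * t ^ 2 ≤ 128 * ((B.card * C.card : ℕ) : ℝ) ^ 3 := by
  rcases X.eq_empty_or_nonempty with rfl | ⟨x₀, hx₀⟩
  · simp only [Finset.card_empty, Nat.cast_zero, zero_mul]
    positivity
  set N := B.card * C.card with hNdef
  have hN' : (0 : ℝ) < N := by exact_mod_cast hN
  have ht0 : 0 < t := by linarith
  -- With 4Ns ≤ t, the diagonal contribution 2sN|X| is at most half of |X|t and is absorbed; the
  -- floor costs at most a factor 2.
  set s := ⌊t / (4 * N)⌋₊ with hs
  have hs1 : 1 ≤ s := by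
    rw [hs, Nat.one_le_floor_iff, le_div_iff₀ (by positivity)]
    linarith
  have hs1' : (1 : ℝ) ≤ s := by exact_mod_cast hs1
  have hst : 4 * N * (s : ℝ) ≤ t := by
    have := Nat.floor_le (a := t / (4 * N)) (by positivity)
    rw [le_div_iff₀ (by positivity)] at this
    linarith
  have hts : t ≤ 8 * N * (s : ℝ) := by
    have := Nat.lt_floor_add_one (t / (4 * (N : ℝ)))
    rw [div_lt_iff₀ (by positivity), ← hs] at this
    nlinarith
  have hbound : ∀ m : ℕ, slopeEnergy B C x₀ ≤ N * m → s ≤ m := by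
    intro m hm
    have h1 : t ≤ N * (m : ℝ) := (h x₀ hx₀).trans (by exact_mod_cast hm)
    have h2 : (N : ℝ) * s ≤ N * m := by nlinarith
    exact_mod_cast le_of_mul_le_mul_left h2 hN'
  obtain ⟨u, hum, hus, huc⟩ := exists_monotone_equipartition B s hs1
    (hbound _ (slopeEnergy_le_mul_card_left B C x₀))
  obtain ⟨v, hvm, hvs, hvc⟩ := exists_monotone_equipartition C s hs1
    (hbound _ (slopeEnergy_le_mul_card_right B C (hX _ hx₀)))
  set R := collisions u B * collisions v C with hR
  have hRle : s ^ 2 * R ≤ 4 * N ^ 2 := by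
    calc s ^ 2 * R = (s * collisions u B) * (s * collisions v C) := by rw [hR]; ring
      _ ≤ (2 * B.card ^ 2) * (2 * C.card ^ 2) :=
        Nat.mul_le_mul (mul_card_pairs_same_class_le B s u huc)
          (mul_card_pairs_same_class_le C s v hvc)
      _ = 4 * N ^ 2 := by rw [hNdef]; ring
  have hsum : ∑ x ∈ X, slopeEnergy B C x ≤ 2 * s * (X.card * N + R) := by
    refine (Finset.sum_le_sum fun x _ =>
      slopeEnergy_le_mul_blocks B C x s u v hum hvm hus hvs).trans ?_
    rw [← Finset.mul_sum]
    exact Nat.mul_le_mul_left _ (sum_card_line_block_le B C X u v)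
  have hlow : (X.card : ℝ) * t ≤ 2 * s * (X.card * N + R) := by
    calc (X.card : ℝ) * t = ∑ x ∈ X, t := by rw [Finset.sum_const, nsmul_eq_mul]
      _ ≤ ∑ x ∈ X, (slopeEnergy B C x : ℝ) := Finset.sum_le_sum h
      _ ≤ _ := by exact_mod_cast hsum
  have hRle' : (s : ℝ) ^ 2 * R ≤ 4 * (N : ℝ) ^ 2 := by exact_mod_cast hRle
  have hXt : (X.card : ℝ) * t ≤ 4 * s * R := by
    have := mul_le_mul_of_nonneg_left hst (Nat.cast_nonneg (α := ℝ) X.card)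
    linarith
  calc (X.card : ℝ) * t ^ 2 = (X.card * t) * t := by ring
    _ ≤ (4 * s * R) * (8 * N * s) := by gcongr
    _ = 32 * N * (s ^ 2 * R) := by ring
    _ ≤ 32 * N * (4 * N ^ 2) := by gcongr
    _ = 128 * (N : ℝ) ^ 3 := by ring

/-! ### Second moments. -/

/-- A quadratic tail bound on the superlevel sets bounds the second moment up to a logarithm. -/
lemma sum_sq_le_mul_harmonic {α : Type*} [DecidableEq α] (f : α → ℝ) (K t₀ : ℝ)
    (n : ℕ) : ∀ X : Finset α, X.card = n → (∀ x ∈ X, t₀ ≤ f x) →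
      (∀ Y ⊆ X, ∀ t, t₀ ≤ t → (∀ x ∈ Y, t ≤ f x) → (Y.card : ℝ) * t ^ 2 ≤ K) →
      ∑ x ∈ X, f x ^ 2 ≤ K * (harmonic n : ℝ) := by
  induction n with
  | zero =>
    intro X hX _ _
    simp [Finset.card_eq_zero.1 hX]
  | succ n ih =>
    intro X hX hf hK
    -- The tail bound at the minimum of f over n + 1 points gives f(x₀)² ≤ K/(n+1); peeling off
    -- minima sums these to a harmonic number.
    obtain ⟨x₀, hx₀, hmin⟩ := X.exists_min_image f (Finset.card_pos.1 (by omega))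
    have h1 := ih (X.erase x₀) (by rw [Finset.card_erase_of_mem hx₀, hX]; rfl)
      (fun x hx => hf x (Finset.mem_of_mem_erase hx))
      (fun Y hY => hK Y (hY.trans (Finset.erase_subset _ _)))
    have h2 := hK X subset_rfl (f x₀) (hf x₀ hx₀) hmin
    rw [← Finset.add_sum_erase X _ hx₀, harmonic_succ]
    push_cast
    rw [hX] at h2
    push_cast at h2
    have h3 : f x₀ ^ 2 ≤ K * ((n : ℝ) + 1)⁻¹ := by
      rw [← div_eq_mul_inv, le_div_iff₀ (by positivity)]
      linarith
    rw [mul_add]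
    linarith

lemma sum_slopeEnergy_sq_le (B C X : Finset ℝ) (hX : ∀ x ∈ X, x ≠ 0)
    (hN : 0 < B.card * C.card) :
    ∑ x ∈ X.filter (fun x => 4 * ((B.card * C.card : ℕ) : ℝ) ≤ slopeEnergy B C x),
        (slopeEnergy B C x : ℝ) ^ 2 ≤
      128 * ((B.card * C.card : ℕ) : ℝ) ^ 3 * (1 + Real.log X.card) := by
  set Y := X.filter (fun x => 4 * ((B.card * C.card : ℕ) : ℝ) ≤ slopeEnergy B C x) with hY
  have h1 := sum_sq_le_mul_harmonic (fun x => (slopeEnergy B C x : ℝ))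
    (128 * ((B.card * C.card : ℕ) : ℝ) ^ 3) (4 * ((B.card * C.card : ℕ) : ℝ))
    Y.card Y rfl (fun x hx => (Finset.mem_filter.1 hx).2)
    (fun Z hZ t ht h => card_mul_sq_le_of_le_slopeEnergy B C Z
      (fun x hx => hX x (Finset.mem_filter.1 (hZ hx)).1) t hN ht h)
  refine h1.trans (mul_le_mul_of_nonneg_left ?_ (by positivity))
  refine (harmonic_le_one_add_log _).trans ?_
  rcases Nat.eq_zero_or_pos Y.card with h0 | h0
  · rw [h0]
    simpa using Real.log_natCast_nonneg X.card
  · have : (Y.card : ℝ) ≤ X.card := by exact_mod_cast Finset.card_le_card (Finset.filter_subset _ _)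
    have := Real.log_le_log (by exact_mod_cast h0) this
    linarith

/-- The pairs in `B × C` with nonzero sum. -/
noncomputable def nonzeroSumPairs (B C : Finset ℝ) : Finset (ℝ × ℝ) :=
  (B ×ˢ C).filter fun p => p.1 + p.2 ≠ 0

/-- The number of representations of `x` as a ratio of nonzero elements of `B + C`,
counted with multiplicity. -/
noncomputable def sumRatioCount (B C : Finset ℝ) (x : ℝ) : ℕ :=
  ((nonzeroSumPairs B C ×ˢ nonzeroSumPairs B C).filter fun z : (ℝ × ℝ) × (ℝ × ℝ) =>
    z.2.1 + z.2.2 = x * (z.1.1 + z.1.2)).card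

/-- Rewrite b' + c' = x(b + c) as c' − xb = −(b' − xc): a coincidence between (b, c') in B × C and
(c, b') in C × B. -/
lemma two_mul_sumRatioCount_le (B C : Finset ℝ) (x : ℝ) :
    2 * sumRatioCount B C x ≤ slopeEnergy B C x + slopeEnergy C B x := by
  refine le_trans (Nat.mul_le_mul_left 2 ?_) (two_mul_card_pairs_le
    (fun p : ℝ × ℝ => p.2 - x * p.1) (fun p : ℝ × ℝ => -(p.2 - x * p.1)) (B ×ˢ C) (C ×ˢ B) |>.trans
      (le_of_eq ?_))
  · refine Finset.card_le_card_of_injOn (fun z => ((z.1.1, z.2.2), (z.1.2, z.2.1)))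
      (fun z hz => ?_) ?_
    · simp only [Finset.coe_filter, Finset.mem_product, Set.mem_ofPred_eq, nonzeroSumPairs,
        Finset.mem_filter] at hz
      simp only [Finset.mem_coe, Finset.mem_product, Finset.mem_filter]
      refine ⟨by tauto, ?_⟩
      linarith [hz.2]
    · rintro ⟨⟨a, b⟩, ⟨c, d⟩⟩ _ ⟨⟨a', b'⟩, ⟨c', d'⟩⟩ _ h
      simp only [Prod.mk.injEq] at h ⊢
      tauto
  · simp only [slopeEnergy, collisions, neg_inj]

lemma sum_sumRatioCount_le (B C X : Finset ℝ) :
    ∑ x ∈ X, sumRatioCount B C x ≤ (B.card * C.card) ^ 2 := by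
  simp only [sumRatioCount]
  rw [← Finset.card_biUnion]
  · rw [sq, ← Finset.card_product, ← Finset.card_product]
    refine Finset.card_le_card fun z hz => ?_
    simp only [Finset.mem_biUnion, Finset.mem_filter, Finset.mem_product, nonzeroSumPairs] at hz
    simp only [Finset.mem_product]
    tauto
  · intro x _ y _ hxy
    refine Finset.disjoint_left.2 fun z hz hz' => hxy ?_
    simp only [Finset.mem_filter, Finset.mem_product, nonzeroSumPairs] at hz hz'
    exact mul_right_cancel₀ hz.1.1.2 (hz.2.symm.trans hz'.2)

lemma sum_sumRatioCount_sq_le (B C X : Finset ℝ) (hX : ∀ x ∈ X, x ≠ 0)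
    (hN : 0 < B.card * C.card) :
    ∑ x ∈ X, (sumRatioCount B C x : ℝ) ^ 2 ≤
      260 * ((B.card * C.card : ℕ) : ℝ) ^ 3 * (1 + Real.log X.card) := by
  have hF := sum_slopeEnergy_sq_le B C X hX hN
  have hG := sum_slopeEnergy_sq_le C B X hX (by rwa [mul_comm])
  rw [mul_comm C.card B.card] at hG
  set N := B.card * C.card with hNdef
  rw [Finset.sum_filter] at hF hG
  have hS : ∑ x ∈ X, (sumRatioCount B C x : ℝ) ≤ (N : ℝ) ^ 2 := by
    exact_mod_cast sum_sumRatioCount_le B C X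
  -- If both energies are below 4N then q ≤ 4N and q² ≤ 4Nq, summed by the first moment; otherwise q
  -- is at most the larger energy, which is in the tail.
  have hpt : ∀ x ∈ X, (sumRatioCount B C x : ℝ) ^ 2 ≤
      4 * N * sumRatioCount B C x +
      ((if 4 * (N : ℝ) ≤ slopeEnergy B C x then (slopeEnergy B C x : ℝ) ^ 2 else 0) +
       (if 4 * (N : ℝ) ≤ slopeEnergy C B x then (slopeEnergy C B x : ℝ) ^ 2 else 0)) := by
    intro x _
    have h2 : 2 * (sumRatioCount B C x : ℝ) ≤ slopeEnergy B C x + slopeEnergy C B x := by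
      exact_mod_cast two_mul_sumRatioCount_le B C x
    have hq : (0 : ℝ) ≤ sumRatioCount B C x := Nat.cast_nonneg _
    have hN0 : (0 : ℝ) ≤ N := Nat.cast_nonneg _
    have hNq := mul_nonneg hN0 hq
    generalize (sumRatioCount B C x : ℝ) = q at *
    generalize (slopeEnergy B C x : ℝ) = F at *
    generalize (slopeEnergy C B x : ℝ) = G at *
    split_ifs with h3 h4 h4
    · rcases le_total F G with h | h
      · nlinarith [sq_nonneg F]
      · nlinarith [sq_nonneg G]
    · nlinarith
    · nlinarith
    · nlinarith
  have hlog : 0 ≤ Real.log X.card := Real.log_natCast_nonneg _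
  have hN3 : (0 : ℝ) ≤ (N : ℝ) ^ 3 := by positivity
  calc _ ≤ _ := Finset.sum_le_sum hpt
    _ ≤ 4 * N * (N : ℝ) ^ 2 + (128 * (N : ℝ) ^ 3 * (1 + Real.log X.card) +
        128 * (N : ℝ) ^ 3 * (1 + Real.log X.card)) := by
      rw [Finset.sum_add_distrib, Finset.sum_add_distrib, ← Finset.mul_sum]
      gcongr
    _ ≤ _ := by nlinarith [mul_nonneg hN3 hlog]

/-- Zero-sum pairs form a partial matching, so they number at most min(|B|, |C|), which is at most
half of all pairs unless |B| = |C| = 1. Only that case needs B + C ≠ {0}. -/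
lemma card_mul_card_le_two_mul_card_nonzeroSumPairs (B C : Finset ℝ) (h : B + C ≠ {0})
    (hN : 0 < B.card * C.card) : B.card * C.card ≤ 2 * (nonzeroSumPairs B C).card := by
  have hBpos : 0 < B.card := Nat.pos_of_mul_pos_right hN
  have hCpos : 0 < C.card := Nat.pos_of_mul_pos_left hN
  have hsplit := Finset.card_filter_add_card_filter_not (s := B ×ˢ C) fun p => p.1 + p.2 ≠ 0
  rw [Finset.card_product] at hsplit
  set Z := (B ×ˢ C).filter fun p : ℝ × ℝ => ¬ (p.1 + p.2 ≠ 0) with hZ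
  have hsplit' : (nonzeroSumPairs B C).card + Z.card = B.card * C.card := hsplit
  have hZB : Z.card ≤ B.card := by
    refine Finset.card_le_card_of_injOn Prod.fst (fun z hz => ?_) ?_
    · exact (Finset.mem_product.1 (Finset.mem_filter.1 hz).1).1
    · rintro ⟨a, b⟩ hz ⟨a', b'⟩ hz' hab
      have h1 := (Finset.mem_filter.1 hz).2
      have h2 := (Finset.mem_filter.1 hz').2
      simp only [not_not] at h1 h2 hab
      subst hab
      rw [Prod.mk.injEq]
      exact ⟨rfl, by linarith⟩
  have hZC : Z.card ≤ C.card := by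
    refine Finset.card_le_card_of_injOn Prod.snd (fun z hz => ?_) ?_
    · exact (Finset.mem_product.1 (Finset.mem_filter.1 hz).1).2
    · rintro ⟨a, b⟩ hz ⟨a', b'⟩ hz' hab
      have h1 := (Finset.mem_filter.1 hz).2
      have h2 := (Finset.mem_filter.1 hz').2
      simp only [not_not] at h1 h2 hab
      subst hab
      rw [Prod.mk.injEq]
      exact ⟨by linarith, rfl⟩
  by_cases hB : 2 ≤ B.card
  · nlinarith
  by_cases hC : 2 ≤ C.card
  · nlinarith
  obtain ⟨b, rfl⟩ := Finset.card_eq_one.1 (show B.card = 1 by omega)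
  obtain ⟨c, rfl⟩ := Finset.card_eq_one.1 (show C.card = 1 by omega)
  have hbc : b + c ≠ 0 := fun h0 => h (by simp [h0])
  have : nonzeroSumPairs {b} {c} = {(b, c)} := by
    ext ⟨x, y⟩
    simp only [nonzeroSumPairs, Finset.mem_filter, Finset.mem_product, Finset.mem_singleton,
      Prod.mk.injEq]
    constructor
    · exact fun h => h.1
    · rintro ⟨rfl, rfl⟩
      exact ⟨⟨rfl, rfl⟩, hbc⟩
  simp [this]

/-! ### Multiplicative energy and conclusion. -/

lemma collisions_div_le_mulEnergy (A : Finset ℝ) (hA : (0 : ℝ) ∉ A) :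
    collisions (fun p : ℝ × ℝ => p.1 / p.2) (A ×ˢ A) ≤ Finset.mulEnergy A A := by
  rw [collisions, Finset.mulEnergy]
  refine Finset.card_le_card_of_injOn (fun z => ((z.1.1, z.2.1), (z.2.2, z.1.2)))
    (fun z hz => ?_) ?_
  · simp only [Finset.coe_filter, Finset.mem_product, Set.mem_ofPred_eq] at hz
    obtain ⟨⟨⟨h1, h2⟩, h3, h4⟩, h5⟩ := hz
    simp only [Finset.mem_coe, Finset.mem_product, Finset.mem_filter]
    refine ⟨by tauto, ?_⟩
    exact (div_eq_div_iff (ne_of_mem_of_not_mem h2 hA) (ne_of_mem_of_not_mem h4 hA)).1 h5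
  · rintro ⟨⟨a, b⟩, ⟨c, d⟩⟩ _ ⟨⟨a', b'⟩, ⟨c', d'⟩⟩ _ h
    simp only [Prod.mk.injEq] at h ⊢
    tauto

lemma collisions_mul_sum_le (A B C : Finset ℝ) (hA : (0 : ℝ) ∉ A) :
    collisions (fun p : ℝ × (ℝ × ℝ) => p.1 * (p.2.1 + p.2.2)) (A ×ˢ nonzeroSumPairs B C) ≤
      ∑ x ∈ A / A, ((A ×ˢ A).filter fun p => p.1 / p.2 = x).card * sumRatioCount B C x := by
  have hmaps : ∀ z ∈ ((A ×ˢ nonzeroSumPairs B C) ×ˢ (A ×ˢ nonzeroSumPairs B C)).filter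
      (fun z => z.1.1 * (z.1.2.1 + z.1.2.2) = z.2.1 * (z.2.2.1 + z.2.2.2)),
      z.1.1 / z.2.1 ∈ A / A := by
    intro z hz
    simp only [Finset.mem_filter, Finset.mem_product] at hz
    exact Finset.div_mem_div hz.1.1.1 hz.1.2.1
  rw [collisions, Finset.card_eq_sum_card_fiberwise hmaps]
  refine Finset.sum_le_sum fun x _ => ?_
  rw [sumRatioCount, ← Finset.card_product]
  refine Finset.card_le_card_of_injOn (fun z => ((z.1.1, z.2.1), (z.1.2, z.2.2)))
    (fun z hz => ?_) ?_
  · simp only [Finset.coe_filter, Finset.mem_filter, Finset.mem_product, Set.mem_ofPred_eq] at hz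
    obtain ⟨⟨⟨⟨h1, h2⟩, h3, h4⟩, h5⟩, h6⟩ := hz
    simp only [Finset.mem_coe, Finset.mem_product, Finset.mem_filter]
    refine ⟨⟨⟨h1, h3⟩, h6⟩, ⟨h2, h4⟩, ?_⟩
    have h0 := ne_of_mem_of_not_mem h3 hA
    rw [← h6, div_mul_eq_mul_div, eq_div_iff h0]
    linarith
  · rintro ⟨⟨a, b⟩, ⟨c, d⟩⟩ _ ⟨⟨a', b'⟩, ⟨c', d'⟩⟩ _ h
    simp only [Prod.mk.injEq] at h ⊢
    tauto

lemma collisions_mul_sum_sq_le (A B C : Finset ℝ) (hA : (0 : ℝ) ∉ A)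
    (hN : 0 < B.card * C.card) :
    (collisions (fun p : ℝ × (ℝ × ℝ) => p.1 * (p.2.1 + p.2.2))
        (A ×ˢ nonzeroSumPairs B C) : ℝ) ^ 2 ≤
      Finset.mulEnergy A A *
        (260 * ((B.card * C.card : ℕ) : ℝ) ^ 3 * (1 + Real.log (A / A).card)) := by
  have h1 : (collisions (fun p : ℝ × (ℝ × ℝ) => p.1 * (p.2.1 + p.2.2))
      (A ×ˢ nonzeroSumPairs B C) : ℝ) ≤
      ∑ x ∈ A / A, (((A ×ˢ A).filter fun p => p.1 / p.2 = x).card : ℝ) * sumRatioCount B C x := by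
    exact_mod_cast collisions_mul_sum_le A B C hA
  have hmaps : ∀ p ∈ A ×ˢ A, p.1 / p.2 ∈ A / A := fun p hp =>
    Finset.div_mem_div (Finset.mem_product.1 hp).1 (Finset.mem_product.1 hp).2
  have h2 : ∑ x ∈ A / A, (((A ×ˢ A).filter fun p => p.1 / p.2 = x).card : ℝ) ^ 2 ≤
      Finset.mulEnergy A A := by
    have := collisions_div_le_mulEnergy A hA
    rw [collisions_eq_sum_sq _ _ (A / A) hmaps] at this
    exact_mod_cast this
  have hX : ∀ x ∈ A / A, x ≠ 0 := by
    intro x hx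
    obtain ⟨a, ha, b, hb, rfl⟩ := Finset.mem_div.1 hx
    exact div_ne_zero (ne_of_mem_of_not_mem ha hA) (ne_of_mem_of_not_mem hb hA)
  have h3 := sum_sumRatioCount_sq_le B C (A / A) hX hN
  calc _ ≤ (∑ x ∈ A / A,
        (((A ×ˢ A).filter fun p => p.1 / p.2 = x).card : ℝ) * sumRatioCount B C x) ^ 2 := by
        gcongr
    _ ≤ _ := Finset.sum_mul_sq_le_sq_mul_sq _ _ _
    _ ≤ _ := by gcongr

lemma card_pow_four_mul_le (A B C : Finset ℝ) (hA : (0 : ℝ) ∉ A) (hBC : B + C ≠ {0})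
    (hN : 0 < B.card * C.card) :
    (A.card : ℝ) ^ 4 * ((B.card * C.card : ℕ) : ℝ) ≤
      4160 * (Finset.mulEnergy A A * ((A * (B + C)).card : ℝ) ^ 2 *
        (1 + Real.log (A / A).card)) := by
  have hM := card_mul_card_le_two_mul_card_nonzeroSumPairs B C hBC hN
  have h1 := card_sq_le_card_mul_collisions
    (fun p : ℝ × (ℝ × ℝ) => p.1 * (p.2.1 + p.2.2)) (A ×ˢ nonzeroSumPairs B C) (A * (B + C))
    (fun p hp => by
      simp only [Finset.mem_product, nonzeroSumPairs, Finset.mem_filter] at hp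
      exact Finset.mul_mem_mul hp.1 (Finset.add_mem_add hp.2.1.1 hp.2.1.2))
  have h2 := collisions_mul_sum_sq_le A B C hA hN
  rw [Finset.card_product] at h1
  set N := B.card * C.card with hNdef
  generalize collisions (fun p : ℝ × (ℝ × ℝ) => p.1 * (p.2.1 + p.2.2))
    (A ×ˢ nonzeroSumPairs B C) = S at *
  generalize (nonzeroSumPairs B C).card = M at *
  generalize (A * (B + C)).card = W at *
  have hN' : (0 : ℝ) < N := by exact_mod_cast hN
  have hM' : (N : ℝ) ≤ 2 * M := by exact_mod_cast hM
  have h1' : ((A.card : ℝ) * M) ^ 2 ≤ W * S := by exact_mod_cast h1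
  have h3 : ((A.card : ℝ) * N) ^ 2 ≤ 4 * (W * S) := by
    calc ((A.card : ℝ) * N) ^ 2 ≤ ((A.card : ℝ) * (2 * M)) ^ 2 := by gcongr
      _ = 4 * ((A.card : ℝ) * M) ^ 2 := by ring
      _ ≤ _ := by gcongr
  have h4 : (A.card : ℝ) ^ 4 * N * (N : ℝ) ^ 3 ≤
      4160 * (Finset.mulEnergy A A * (W : ℝ) ^ 2 * (1 + Real.log (A / A).card)) * (N : ℝ) ^ 3 := by
    calc (A.card : ℝ) ^ 4 * N * (N : ℝ) ^ 3 = (((A.card : ℝ) * N) ^ 2) ^ 2 := by ring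
      _ ≤ (4 * ((W : ℝ) * S)) ^ 2 := by gcongr
      _ = 16 * (W : ℝ) ^ 2 * (S : ℝ) ^ 2 := by ring
      _ ≤ 16 * (W : ℝ) ^ 2 * (Finset.mulEnergy A A *
        (260 * (N : ℝ) ^ 3 * (1 + Real.log (A / A).card))) := by gcongr
      _ = _ := by ring
  exact le_of_mul_le_mul_right h4 (by positivity)

theorem lemma2p3 :
    ∃ c : ℝ, 0 < c ∧ ∀ A B C : Finset ℝ, 2 ≤ A.card → B + C ≠ {0} →
      c * ((A.card : ℝ) ^ 4 * (B.card : ℝ) * (C.card : ℝ) / Real.logb 2 (A.card : ℝ)) ≤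
        (Finset.mulEnergy A A : ℝ) * ((A * (B + C)).card : ℝ) ^ 2 := by
  -- 199680 = 16 · 4160 · 3: 2⁴ from deleting 0 from A, and 3 from 1 + 2 log|A| ≤ 3 log₂|A|.
  refine ⟨1 / 199680, by norm_num, fun A B C hA hBC => ?_⟩
  rcases Nat.eq_zero_or_pos (B.card * C.card) with hN | hN
  · have : (B.card : ℝ) * C.card = 0 := by exact_mod_cast hN
    rw [mul_assoc ((A.card : ℝ) ^ 4), this]
    simp only [mul_zero, zero_div]
    positivity
  have hA2 : (2 : ℝ) ≤ A.card := by exact_mod_cast hA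
  set A' := A.erase 0 with hA'
  have hsub : A' ⊆ A := Finset.erase_subset _ _
  have hcard : A.card ≤ 2 * A'.card := by
    have : A.card - 1 ≤ A'.card := Finset.pred_card_le_card_erase
    omega
  have hcard' : (A.card : ℝ) ≤ 2 * A'.card := by exact_mod_cast hcard
  have hmain := card_pow_four_mul_le A' B C (Finset.notMem_erase _ _) hBC hN
  have hE : (Finset.mulEnergy A' A' : ℝ) ≤ Finset.mulEnergy A A := by
    exact_mod_cast Finset.mulEnergy_mono hsub hsub
  have hW : ((A' * (B + C)).card : ℝ) ≤ (A * (B + C)).card := by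
    exact_mod_cast Finset.card_le_card (Finset.mul_subset_mul_right hsub)
  have hlogb : 1 ≤ Real.logb 2 A.card := by
    rw [Real.le_logb_iff_rpow_le (by norm_num) (by linarith), Real.rpow_one]
    exact hA2
  have hlog : 1 + Real.log (A' / A').card ≤ 3 * Real.logb 2 A.card := by
    have h1 : ((A' / A').card : ℝ) ≤ (A.card : ℝ) ^ 2 := by
      have : (A' / A').card ≤ A.card * A.card :=
        Finset.card_div_le.trans (Nat.mul_le_mul (Finset.card_le_card hsub)
          (Finset.card_le_card hsub))
      rw [sq]
      exact_mod_cast this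
    have h0 : 0 < (A' / A').card :=
      Finset.card_pos.2 (Finset.Nonempty.div (Finset.card_pos.1 (by omega))
        (Finset.card_pos.1 (by omega)))
    have h2 := Real.log_le_log (by exact_mod_cast h0) h1
    rw [Real.log_pow] at h2
    push_cast at h2
    have h3 : Real.log A.card ≤ Real.logb 2 A.card := by
      rw [Real.logb, le_div_iff₀ (Real.log_pos (by norm_num))]
      have h4 := Real.log_two_lt_d9
      have h5 : 0 ≤ Real.log A.card := Real.log_natCast_nonneg _
      nlinarith
    linarith
  have hlog0 : 0 ≤ 1 + Real.log (A' / A').card := by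
    have := Real.log_natCast_nonneg (A' / A').card
    linarith
  rw [mul_div_assoc', div_le_iff₀ (by linarith)]
  have hchain : (A.card : ℝ) ^ 4 * ((B.card * C.card : ℕ) : ℝ) ≤
      199680 * (Finset.mulEnergy A A * ((A * (B + C)).card : ℝ) ^ 2 * Real.logb 2 A.card) := by
    calc (A.card : ℝ) ^ 4 * ((B.card * C.card : ℕ) : ℝ)
        ≤ (2 * (A'.card : ℝ)) ^ 4 * ((B.card * C.card : ℕ) : ℝ) := by gcongr
      _ = 16 * ((A'.card : ℝ) ^ 4 * ((B.card * C.card : ℕ) : ℝ)) := by ring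
      _ ≤ 16 * (4160 * (Finset.mulEnergy A' A' * ((A' * (B + C)).card : ℝ) ^ 2 *
        (1 + Real.log (A' / A').card))) := by gcongr
      _ ≤ 16 * (4160 * (Finset.mulEnergy A A * ((A * (B + C)).card : ℝ) ^ 2 *
        (3 * Real.logb 2 A.card))) := by gcongr
      _ = _ := by ring
  push_cast at hchain
  linarith
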